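/- Logarithms are to base $2$. A deterministic channel with two disturbance constraints consists of finite alphabets $\mathcal X,\mathcal Y,\mathcal Z_1,\mathcal Z_2$ and functions $y:\mathcal X\to\mathcal Y$, $z_j:\mathcal X\to\mathcal Z_j$ ($j=1,2$); when $x^n\in\mathcal X^n$ is sent, the outputs are $Y_i=y(x_i)$ and $Z_{j,i}=z_j(x_i)$ for $i=1,\dots,n$ (it is the special case of a discrete memoryless channel $p(y,z_1,z_2\mid x)$ in which the outputs are functions of the input). For $R\ge 0$, a $(2^{nR},n)$ code consists of the message set $\{1,\dots,\lceil 2^{nR}\rceil\}$, an encoder $x^n$ from messages to $\mathcal X^n$ and a decoder $\hat m$ from $\mathcal Y^n$ to messages; the message $M$ is uniformly distributed, $X^n=x^n(M)$ and $\hat M=\hat m(Y^n)$. A triple $(R,R_{\mathrm d,1},R_{\mathrm d,2})\in\mathbb R_{+}^3$ (nonnegative entries) is achievable if there is a sequence, over $n$, of $(2^{nR},n)$ codes with $$\lim_{n\to\infty}\Pr(\hat M\ne M)=0,\qquad \limsup_{n\to\infty}\tfrac1n I(X^n;Z_j^n)\le R_{\mathrm d,j}\quad(j=1,2).$$ The rate--disturbance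 region $\mathscr R$ is the closure of the set of achievable triples. Say that $Z_1$ refines $Z_2$ if the partition of $\mathcal X$ into the fibres of $z_1$ is a refinement of the partition into the fibres of $z_2$, i.e. $z_1(x)=z_1(x')$ implies $z_2(x)=z_2(x')$. **Corollary.** Suppose that $Z_1$ refines $Z_2$ or $Z_2$ refines $Z_1$. Then the rate--disturbance region $\mathscr R$ is exactly the set of triples $(R,R_{\mathrm d,1},R_{\mathrm d,2})\in\mathbb R_+^3$ such that $$R\le H(Y),\qquad R-R_{\mathrm d,1}\le H(Y\mid Z_1),\qquad R-R_{\mathrm d,2}\le H(Y\mid Z_2)$$ for some pmf $p(x)$ on $\mathcal X$, where $X\sim p(x)$, $Y=y(X)$ and $Z_j=z_j(X)$. -/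

import Mathlib

open Filter Topology

noncomputable section

namespace Disturbance

/-! ### Shannon information measures on finite probability spaces (logarithms of base 2) -/

section Information

variable {Ω A B : Type*} [Fintype Ω] [Fintype A] [Fintype B]

open Classical in
/-- The pmf of the random variable `f` on the finite probability space `Ω` with pmf `P`. -/
def law (P : Ω → ℝ) (f : Ω → A) (a : A) : ℝ := ∑ ω, if f ω = a then P ω else 0

/-- Entropy in bits of a pmf: the sum of `-q a * log₂ (q a)`, where `0 * log₂ 0 = 0`. -/
def pmfEntropy (q : A → ℝ) : ℝ := ∑ a, -(q a * Real.logb 2 (q a))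

/-- `H(f)`. -/
def entropy (P : Ω → ℝ) (f : Ω → A) : ℝ := pmfEntropy (law P f)

/-- `H(f | g)`: the average over `b ~ g` of the entropy of the conditional pmf of `f` given
`g = b` (values `b` of probability zero contribute zero). -/
def condEntropy (P : Ω → ℝ) (f : Ω → A) (g : Ω → B) : ℝ :=
  ∑ b, law P g b * pmfEntropy (fun a => law P (fun ω => (f ω, g ω)) (a, b) / law P g b)

/-- `I(f ; g) = H(f) - H(f | g)`. -/
def mutualInfo (P : Ω → ℝ) (f : Ω → A) (g : Ω → B) : ℝ :=
  entropy P f - condEntropy P f g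

end Information

/-! ### Communication with disturbance constraints -/

/-- A discrete memoryless channel with `K` disturbance constraints: a conditional pmf
`p(y, z_1, …, z_K | x)`. -/
abbrev Channel (K : ℕ) (X Y : Type*) (Z : Fin K → Type*) [Fintype Y] [∀ j, Fintype (Z j)] :=
  X → stdSimplex ℝ (Y × (∀ j, Z j))

open Classical in
/-- The deterministic channel with `Y = y(X)` and `Z_j = z_j(X)`. -/
def deterministicChannel {K : ℕ} {X Y : Type*} {Z : Fin K → Type*} [Fintype Y]
    [∀ j, Fintype (Z j)] (y : X → Y) (z : ∀ j, X → Z j) : Channel K X Y Z :=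
  fun x => ⟨Pi.single (y x, fun j => z j x) 1, single_mem_stdSimplex ℝ _⟩

/-- The number of messages in a `(2^{nR}, n)` code, rounded up to an integer. -/
def numMessages (R : ℝ) (n : ℕ) : ℕ := ⌈(2 : ℝ) ^ (n * R)⌉₊

/-- A `(2^{nR}, n)` code. -/
structure Code (X Y : Type*) (R : ℝ) (n : ℕ) where
  enc : Fin (numMessages R n) → Fin n → X
  dec : (Fin n → Y) → Fin (numMessages R n)

namespace Code

variable {K : ℕ} {X Y : Type*} {Z : Fin K → Type*} [Fintype X] [Fintype Y]
  [∀ j, Fintype (Z j)] {R : ℝ} {n : ℕ}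

/-- The joint pmf of the uniformly distributed message and of the `n` channel outputs
`(Y_i, Z_{1i}, …, Z_{Ki})`, when the codeword of the message is sent over the memoryless
channel `W`. -/
def jointPmf (c : Code X Y R n) (W : Channel K X Y Z)
    (ω : Fin (numMessages R n) × (Fin n → Y × (∀ j, Z j))) : ℝ :=
  (1 / (numMessages R n : ℝ)) * ∏ i, (W (c.enc ω.1 i)).1 (ω.2 i)

open Classical in
/-- The probability of error `P(M̂ ≠ M)`, where `M̂` is decoded from `Y^n`. -/
def errorProb (c : Code X Y R n) (W : Channel K X Y Z) : ℝ :=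
  ∑ ω, if c.dec (fun i => (ω.2 i).1) ≠ ω.1 then c.jointPmf W ω else 0

/-- The disturbance rate `(1/n) I(X^n; Z_j^n)` at side receiver `j`. -/
def disturbance (c : Code X Y R n) (W : Channel K X Y Z) (j : Fin K) : ℝ :=
  (1 / (n : ℝ)) * mutualInfo (c.jointPmf W) (fun ω => c.enc ω.1) (fun ω i => (ω.2 i).2 j)

end Code

/-- Achievability of the rate--disturbance tuple `(t.1, t.2 1, …, t.2 K)`. The limit superior is
taken in the extended reals. -/
def Achievable {K : ℕ} {X Y : Type*} {Z : Fin K → Type*} [Fintype X] [Fintype Y]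
    [∀ j, Fintype (Z j)] (W : Channel K X Y Z) (t : ℝ × (Fin K → ℝ)) : Prop :=
  0 ≤ t.1 ∧ (∀ j, 0 ≤ t.2 j) ∧
    ∃ c : (n : ℕ) → Code X Y t.1 n,
      Tendsto (fun n => (c n).errorProb W) atTop (𝓝 0) ∧
      ∀ j, limsup (fun n => (((c n).disturbance W j : ℝ) : EReal)) atTop ≤ ((t.2 j : ℝ) : EReal)

/-- The rate--disturbance region: the closure of the set of achievable tuples. -/
def rateDisturbanceRegion {K : ℕ} {X Y : Type*} {Z : Fin K → Type*} [Fintype X] [Fintype Y]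
    [∀ j, Fintype (Z j)] (W : Channel K X Y Z) : Set (ℝ × (Fin K → ℝ)) :=
  closure {t | Achievable W t}

/-- The partition of `X` into the fibres of `f` is a refinement of the one into the fibres of `g`
(so `g` is degraded with respect to `f`). -/
def Refines {X A B : Type*} (f : X → A) (g : X → B) : Prop := Setoid.ker f ≤ Setoid.ker g

end Disturbance

end

open Filter Topology

noncomputable section

namespace Disturbance

/-! ### Entropy on a finite probability space -/

section Information

variable {Ω A B : Type*} [Fintype Ω] [Fintype A] [Fintype B]

/-! The outputs are functions of the input, so the disturbance is `H(Z_j^n)/n`.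

Converse (`logb_card_le`; no refinement is needed). Let `p` be the input pmf averaged over time.
Gibbs' inequality compares the uniform pmf on `M` messages with the weights (law of the side output
`b^n`) × `∏ q(y_i | b_i)` × (smoothed decoder guess), where `q` is the conditional pmf under `p`.
This gives in one step `(1 - P_e) log M ≤ H(b^n) + n H(Y | b) + 1`. A constant `b` gives `R ≤ H(Y)`,
and `b = z_j` gives the other bounds. The single-letter region is closed because the simplex is
compact and entropy is continuous.

Achievability is combinatorial, with zero error. Suppose `a` refines `b`, and let `x` be a sequence
of type close to `p`. To first order in the exponent, the orbit of `y(x)` has size `2^{nH(Y)}` under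
all permutations, `2^{nH(Y|b)}` under the stabilizer of `b(x)` and `2^{nH(Y|a)}` under that of
`a(x)` (`tendsto_logb_ncard_orbit`). By refinement these groups form a chain `H₁ ≤ H₂ ≤ G`. Inputs
`g h s • x` with `s ∈ H₁`, `m` choices of `h ∈ H₂` and `k` choices of `g` have at most `k` side
outputs `b` and `k m` side outputs `a`. Greedy covering (`exists_two_level_cover`) makes them reach,
up to a factor 4, `min(|O|, k min(|O_b|, m |O_a|))` outputs `y`. One codeword per output, with `k`
and `m` exponentials matched to the disturbance budgets, gives the code. -/

theorem sum_law_mul (P : Ω → ℝ) (f : Ω → A) (φ : A → ℝ) :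
    ∑ a, law P f a * φ a = ∑ ω, P ω * φ (f ω) := by
  classical
  simp only [law, Finset.sum_mul, ite_mul, zero_mul]
  rw [Finset.sum_comm]
  simp

theorem sum_law (P : Ω → ℝ) (f : Ω → A) : ∑ a, law P f a = ∑ ω, P ω := by
  simpa using sum_law_mul P f (fun _ => 1)

theorem law_nonneg {A : Type*} {P : Ω → ℝ} (hP : ∀ ω, 0 ≤ P ω) (f : Ω → A) (a : A) : 0 ≤ law P f a :=
  Finset.sum_nonneg fun ω _ => by split_ifs <;> simp [hP]

theorem le_law {A : Type*} {P : Ω → ℝ} (hP : ∀ ω, 0 ≤ P ω) (f : Ω → A) (ω : Ω) : P ω ≤ law P f (f ω) := by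
  classical
  have := Finset.single_le_sum (f := fun ω' => if f ω' = f ω then P ω' else 0)
    (fun ω' _ => by split_ifs <;> simp [hP]) (Finset.mem_univ ω)
  simpa [law] using this

theorem law_law {B : Type*} (P : Ω → ℝ) (f : Ω → A) (g : A → B) :
    law (law P f) g = fun b => law P (fun ω => g (f ω)) b := by
  classical
  funext b
  simpa [law] using sum_law_mul P f (fun a => if g a = b then 1 else 0)

theorem law_snd {B : Type*} (P : Ω → ℝ) (f : Ω → A) (g : Ω → B) (b : B) :
    law P g b = ∑ a, law P (fun ω => (f ω, g ω)) (a, b) := by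
  classical
  simp only [law, Prod.mk.injEq]
  rw [Finset.sum_comm]
  refine Finset.sum_congr rfl fun ω _ => ?_
  by_cases h : g ω = b <;> simp [h]

theorem law_prodMk_eq_of_comp {A C : Type*} (P : Ω → ℝ) (f : Ω → A) (φ : A → C) (ω : Ω) :
    law P (fun ω => (f ω, φ (f ω))) (f ω, φ (f ω)) = law P f (f ω) := by
  simp only [law, Prod.mk.injEq]
  refine Finset.sum_congr rfl fun ω' _ => ?_
  by_cases h : f ω' = f ω <;> simp [h]

theorem entropy_eq_sum (P : Ω → ℝ) (f : Ω → A) :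
    entropy P f = -∑ ω, P ω * Real.logb 2 (law P f (f ω)) := by
  rw [entropy, pmfEntropy, Finset.sum_neg_distrib, sum_law_mul]

theorem condEntropy_eq_sum {P : Ω → ℝ} (hP : ∀ ω, 0 ≤ P ω) (f : Ω → A) (g : Ω → B) :
    condEntropy P f g = -∑ ω, P ω *
      Real.logb 2 (law P (fun ω => (f ω, g ω)) (f ω, g ω) / law P g (g ω)) := by
  rw [← sum_law_mul P (fun ω => (f ω, g ω))
    (fun c => Real.logb 2 (law P (fun ω => (f ω, g ω)) c / law P g c.2)),
    Fintype.sum_prod_type_right, condEntropy, ← Finset.sum_neg_distrib]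
  refine Finset.sum_congr rfl fun b _ => ?_
  rw [pmfEntropy, Finset.mul_sum, ← Finset.sum_neg_distrib]
  refine Finset.sum_congr rfl fun a _ => ?_
  -- A value of probability zero has zero joint probability with every `a`, so both sides vanish
  -- despite the division by zero.
  by_cases h : law P g b = 0
  · have : law P (fun ω => (f ω, g ω)) (a, b) = 0 := by
      rw [law_snd P f g b] at h
      exact (Finset.sum_eq_zero_iff_of_nonneg fun a _ => law_nonneg hP _ _).1 h a
        (Finset.mem_univ a)
    simp [h, this]
  · field_simp

theorem condEntropy_eq_sub {P : Ω → ℝ} (hP : ∀ ω, 0 ≤ P ω) (f : Ω → A) (g : Ω → B) :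
    condEntropy P f g = entropy P (fun ω => (f ω, g ω)) - entropy P g := by
  rw [condEntropy_eq_sum hP, entropy_eq_sum, entropy_eq_sum, ← sub_eq_zero, neg_sub_neg,
    ← Finset.sum_sub_distrib, ← Finset.sum_neg_distrib, ← Finset.sum_sub_distrib]
  refine Finset.sum_eq_zero fun ω _ => ?_
  rcases (hP ω).eq_or_lt with h | h
  · simp [← h]
  · rw [Real.logb_div (h.trans_le (le_law hP (fun ω => (f ω, g ω)) ω)).ne'
      (h.trans_le (le_law hP g ω)).ne']
    ring

theorem condEntropy_comp {C : Type*} [Fintype C] {P : Ω → ℝ} (hP : ∀ ω, 0 ≤ P ω) (f : Ω → A)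
    (φ : A → C) :
    condEntropy P f (fun ω => φ (f ω)) = entropy P f - entropy P (fun ω => φ (f ω)) := by
  rw [condEntropy_eq_sub hP, entropy_eq_sum, entropy_eq_sum P f]
  simp only [law_prodMk_eq_of_comp]

/-- Determinism enters here: the disturbance of a code becomes an output entropy. -/
theorem mutualInfo_comp {C : Type*} [Fintype C] {P : Ω → ℝ} (hP : ∀ ω, 0 ≤ P ω) (f : Ω → A)
    (φ : A → C) : mutualInfo P f (fun ω => φ (f ω)) = entropy P (fun ω => φ (f ω)) := by
  rw [mutualInfo, condEntropy_comp hP, sub_sub_cancel]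

theorem entropy_const {P : Ω → ℝ} (hP : ∑ ω, P ω = 1) (a : A) : entropy P (fun _ => a) = 0 := by
  simp [entropy_eq_sum, law, hP]

theorem condEntropy_const {P : Ω → ℝ} (hP : ∀ ω, 0 ≤ P ω) (hP1 : ∑ ω, P ω = 1) (f : Ω → A)
    (b : B) : condEntropy P f (fun _ => b) = entropy P f := by
  rw [condEntropy_comp hP f (fun _ => b), entropy_const hP1, sub_zero]

/-- Gibbs' inequality. -/
theorem sum_mul_logb_le {p q : A → ℝ} (hp : ∀ a, 0 ≤ p a) (hp1 : ∑ a, p a = 1)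
    (hq : ∀ a, 0 ≤ q a) (hq1 : ∑ a, q a ≤ 1) (hpq : ∀ a, 0 < p a → 0 < q a) :
    ∑ a, p a * Real.logb 2 (q a) ≤ ∑ a, p a * Real.logb 2 (p a) := by
  have hl : 0 < Real.log 2 := Real.log_pos one_lt_two
  have key : ∀ a, p a * Real.logb 2 (q a) ≤
      p a * Real.logb 2 (p a) + (q a - p a) / Real.log 2 := by
    intro a
    rcases (hp a).eq_or_lt with h | h
    · simpa [← h] using div_nonneg (hq a) hl.le
    · have h1 := Real.log_le_sub_one_of_pos (div_pos (hpq a h) h)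
      rw [Real.log_div (hpq a h).ne' h.ne'] at h1
      have h2 := mul_le_mul_of_nonneg_left h1 h.le
      rw [mul_sub, mul_sub, mul_div_cancel₀ _ h.ne'] at h2
      rw [Real.logb, Real.logb, mul_div_assoc', mul_div_assoc', ← add_div]
      gcongr
      linarith
  refine (Finset.sum_le_sum fun a _ => key a).trans ?_
  rw [Finset.sum_add_distrib, ← Finset.sum_div, Finset.sum_sub_distrib, hp1]
  have : (∑ a, q a - 1) / Real.log 2 ≤ 0 := div_nonpos_of_nonpos_of_nonneg (by linarith) hl.le
  linarith

/-- Gibbs' inequality against the uniform pmf on `S`. -/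
theorem entropy_le_logb_card {P : Ω → ℝ} (hP : ∀ ω, 0 ≤ P ω) (hP1 : ∑ ω, P ω = 1) (f : Ω → A)
    (S : Finset A) (hS : ∀ ω, 0 < P ω → f ω ∈ S) : entropy P f ≤ Real.logb 2 S.card := by
  classical
  have hmem : ∀ a, 0 < law P f a → a ∈ S := by
    intro a ha
    by_contra hn
    refine ha.ne' (Finset.sum_eq_zero fun ω _ => ?_)
    split_ifs with h
    · by_contra h0
      exact hn (h ▸ hS ω ((hP ω).lt_of_ne' h0))
    · rfl
  obtain ⟨a₀, ha₀⟩ : ∃ a, 0 < law P f a := by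
    by_contra! h
    have := Finset.sum_nonpos fun a (_ : a ∈ Finset.univ) => h a
    rw [sum_law, hP1] at this
    linarith
  have hc : 0 < (S.card : ℝ) := by exact_mod_cast Finset.card_pos.2 ⟨a₀, hmem a₀ ha₀⟩
  have := sum_mul_logb_le (p := law P f) (q := fun a => if a ∈ S then 1 / (S.card : ℝ) else 0)
    (law_nonneg hP f) (by rw [sum_law, hP1]) (fun a => by split_ifs <;> positivity)
    (by simp [hc.ne']) (fun a ha => by simp [hmem a ha, hc])
  have h2 : ∑ a, law P f a * Real.logb 2 (if a ∈ S then 1 / (S.card : ℝ) else 0) =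
      -Real.logb 2 S.card := by
    calc _ = ∑ a, law P f a * -Real.logb 2 S.card := by
          refine Finset.sum_congr rfl fun a _ => ?_
          rcases (law_nonneg hP f a).eq_or_lt with h | h
          · simp [← h]
          · simp [hmem a h, Real.logb_inv]
      _ = _ := by rw [← Finset.sum_mul, sum_law, hP1, one_mul]
  rw [entropy, pmfEntropy, Finset.sum_neg_distrib]
  linarith

theorem continuous_law {A : Type*} (f : Ω → A) (a : A) : Continuous fun P : Ω → ℝ => law P f a := by
  classical
  unfold law
  exact continuous_finsetSum _ fun ω _ => by split_ifs <;> fun_prop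

theorem continuous_entropy (f : Ω → A) : Continuous fun P : Ω → ℝ => entropy P f := by
  unfold entropy pmfEntropy
  refine continuous_finsetSum _ fun a _ => Continuous.neg ?_
  have : Continuous fun x : ℝ => x * Real.logb 2 x := by
    simpa only [Real.logb, mul_div_assoc] using Real.continuous_mul_log.div_const (Real.log 2)
  exact this.comp (continuous_law f a)

end Information

/-! ### Codes over a deterministic channel -/

section DeterministicChannel

variable {K : ℕ} {X Y : Type*} {Z : Fin K → Type*} [Fintype X] [Fintype Y]
  [∀ j, Fintype (Z j)]

/-- The uniform pmf on `Fin M`. -/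
def unif (M : ℕ) (_ : Fin M) : ℝ := 1 / (M : ℝ)

theorem unif_nonneg (M : ℕ) (m : Fin M) : 0 ≤ unif M m := by unfold unif; positivity

theorem sum_unif {M : ℕ} (hM : 0 < M) : ∑ m, unif M m = 1 := by
  have : (M : ℝ) ≠ 0 := by positivity
  simp [unif, this]

theorem numMessages_pos (R : ℝ) (n : ℕ) : 0 < numMessages R n :=
  Nat.ceil_pos.2 (by positivity)

theorem mul_le_logb_numMessages (R : ℝ) (n : ℕ) : n * R ≤ Real.logb 2 (numMessages R n) := by
  rw [Real.le_logb_iff_rpow_le one_lt_two (by exact_mod_cast numMessages_pos R n)]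
  exact Nat.le_ceil _

/-- The joint pmf lives on the graph of the message-to-output map, so every quantity of a code
reduces to the uniform message. -/
theorem Code.sum_jointPmf_mul {X Y : Type*} [Fintype Y] {R : ℝ} {n : ℕ} (c : Code X Y R n)
    (y : X → Y) (z : ∀ j, X → Z j)
    (φ : Fin (numMessages R n) × (Fin n → Y × (∀ j, Z j)) → ℝ) :
    ∑ ω, c.jointPmf (deterministicChannel y z) ω * φ ω =
      ∑ m, unif _ m * φ (m, fun i => (y (c.enc m i), fun j => z j (c.enc m i))) := by
  classical
  rw [Fintype.sum_prod_type]
  refine Finset.sum_congr rfl fun m _ => ?_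
  have h : ∀ o : Fin n → Y × (∀ j, Z j), c.jointPmf (deterministicChannel y z) (m, o) =
      if o = (fun i => (y (c.enc m i), fun j => z j (c.enc m i))) then
        unif (numMessages R n) m else 0 := by
    intro o
    simp only [Code.jointPmf, deterministicChannel, Pi.single_apply, Finset.prod_boole,
      funext_iff, unif, mul_ite, mul_one, mul_zero, Finset.mem_univ, true_implies]
  simp [h]

theorem Code.law_jointPmf {X Y A : Type*} [Fintype Y] {R : ℝ} {n : ℕ} (c : Code X Y R n)
    (y : X → Y) (z : ∀ j, X → Z j)
    (f : Fin (numMessages R n) × (Fin n → Y × (∀ j, Z j)) → A) :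
    law (c.jointPmf (deterministicChannel y z)) f =
      law (unif _) (fun m => f (m, fun i => (y (c.enc m i), fun j => z j (c.enc m i)))) := by
  classical
  funext a
  simpa [law] using c.sum_jointPmf_mul y z (fun ω => if f ω = a then 1 else 0)

open Classical in
theorem Code.errorProb_deterministic {X Y : Type*} [Fintype Y] {R : ℝ} {n : ℕ}
    (c : Code X Y R n) (y : X → Y) (z : ∀ j, X → Z j) :
    c.errorProb (deterministicChannel y z) =
      ∑ m, if c.dec (fun i => y (c.enc m i)) ≠ m then unif _ m else 0 := by
  simpa [errorProb] using c.sum_jointPmf_mul y z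
    (fun ω => if c.dec (fun i => (ω.2 i).1) = ω.1 then 0 else 1)

theorem Code.disturbance_deterministic {R : ℝ} {n : ℕ} (c : Code X Y R n) (y : X → Y)
    (z : ∀ j, X → Z j) (j : Fin K) :
    c.disturbance (deterministicChannel y z) j =
      (1 / (n : ℝ)) * entropy (unif _) (fun m i => z j (c.enc m i)) := by
  rw [disturbance, ← mutualInfo_comp (unif_nonneg _) c.enc (fun x i => z j (x i))]
  simp only [mutualInfo, entropy, condEntropy, law_jointPmf]

end DeterministicChannel

/-! ### One-shot converse -/

section Converse

variable {M n : ℕ} {X Y B : Type*} [Fintype X] [Fintype Y] [Fintype B]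

/-- The average over time of the pmf of the channel input. -/
def meanInput (enc : Fin M → Fin n → X) (x : X) : ℝ :=
  1 / (n : ℝ) * ∑ i, law (unif M) (fun m => enc m i) x

/-- Single-letterization: an expectation under the mean input is an average over times and messages,
so `n` times a conditional entropy at that pmf is a sum over letters. -/
theorem sum_meanInput_mul (enc : Fin M → Fin n → X) (φ : X → ℝ) :
    ∑ x, meanInput enc x * φ x = 1 / (n : ℝ) * ∑ m, unif M m * ∑ i, φ (enc m i) := by
  simp only [meanInput, mul_assoc, Finset.sum_mul, ← Finset.mul_sum]
  rw [Finset.sum_comm]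
  simp only [sum_law_mul]
  rw [Finset.sum_comm]
  simp only [Finset.mul_sum]

theorem meanInput_nonneg {X : Type*} (enc : Fin M → Fin n → X) (x : X) : 0 ≤ meanInput enc x :=
  mul_nonneg (by positivity) (Finset.sum_nonneg fun _ _ => law_nonneg (unif_nonneg M) _ _)

theorem meanInput_mem_stdSimplex (hM : 0 < M) (hn : 0 < n) (enc : Fin M → Fin n → X) :
    meanInput enc ∈ stdSimplex ℝ X := by
  refine ⟨meanInput_nonneg enc, ?_⟩
  have h := sum_meanInput_mul enc (fun _ => 1)
  have : (n : ℝ) ≠ 0 := by positivity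
  simpa [← Finset.sum_mul, sum_unif hM, this] using h

theorem meanInput_pos {X : Type*} (hM : 0 < M) (hn : 0 < n) (enc : Fin M → Fin n → X)
    (m : Fin M) (i : Fin n) : 0 < meanInput enc (enc m i) := by
  refine mul_pos (by positivity) (lt_of_lt_of_le ?_ (Finset.single_le_sum
    (f := fun i' => law (unif M) (fun m => enc m i') (enc m i))
    (fun _ _ => law_nonneg (unif_nonneg M) _ _) (Finset.mem_univ i)))
  exact lt_of_lt_of_le (by unfold unif; positivity) (le_law (unif_nonneg M) (fun m => enc m i) m)

/-- The map `m ↦ (Zf m, Yf m, m)` is injective, and `r`, `w`, `F` chain together into a sub-pmf on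
its codomain. -/
theorem sum_mul_mul_le_one {T C D : Type*} [Fintype T] [Fintype C] [Fintype D] (Zf : T → C)
    (Yf : T → D) {r : C → ℝ} {w : C → D → ℝ} {F : D → T → ℝ} (hr : ∀ c, 0 ≤ r c)
    (hw : ∀ c d, 0 ≤ w c d) (hF : ∀ d m, 0 ≤ F d m) (hr1 : ∑ c, r c ≤ 1)
    (hw1 : ∀ c, ∑ d, w c d ≤ 1) (hF1 : ∀ d, ∑ m, F d m ≤ 1) :
    ∑ m, r (Zf m) * (w (Zf m) (Yf m) * F (Yf m) m) ≤ 1 := by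
  have h1 : ∀ m, r (Zf m) * (w (Zf m) (Yf m) * F (Yf m) m) ≤
      ∑ c, ∑ d, r c * (w c d * F d m) := by
    intro m
    have hnn : ∀ c d, 0 ≤ r c * (w c d * F d m) := fun c d =>
      mul_nonneg (hr c) (mul_nonneg (hw c d) (hF d m))
    exact (Finset.single_le_sum (f := fun d => r (Zf m) * (w (Zf m) d * F d m))
      (fun d _ => hnn _ d) (Finset.mem_univ (Yf m))).trans
      (Finset.single_le_sum (f := fun c => ∑ d, r c * (w c d * F d m))
        (fun c _ => Finset.sum_nonneg fun d _ => hnn c d) (Finset.mem_univ (Zf m)))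
  calc _ ≤ ∑ m, ∑ c, ∑ d, r c * (w c d * F d m) := Finset.sum_le_sum fun m _ => h1 m
    _ = ∑ c, r c * ∑ d, w c d * ∑ m, F d m := by
        rw [Finset.sum_comm]
        refine Finset.sum_congr rfl fun c _ => ?_
        rw [Finset.sum_comm, Finset.mul_sum]
        simp only [Finset.mul_sum]
    _ ≤ ∑ c, r c * 1 := by
        gcongr with c _
        · exact hr c
        · refine le_trans ?_ (hw1 c)
          exact Finset.sum_le_sum fun d _ => mul_le_of_le_one_right (hw c d) (hF1 d)
    _ ≤ 1 := by simpa using hr1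

open Classical in
/-- The weights in the proof of Fano's inequality. -/
theorem sum_guess_le_one (m₀ : Fin M) :
    ∑ m, (if m₀ = m then (1 / 2 : ℝ) else 1 / (2 * M)) ≤ 1 := by
  have hM : (M : ℝ) ≠ 0 := by have := m₀.pos; positivity
  calc _ ≤ ∑ m, ((if m₀ = m then (1 / 2 : ℝ) else 0) + 1 / (2 * M)) := by
        gcongr with m
        split_ifs
        · exact le_add_of_nonneg_right (by positivity)
        · simp
    _ = 1 := by
        rw [Finset.sum_add_distrib]
        simp
        field_simp
        norm_num

open Classical in
/-- A one-shot converse: the message size is bounded by the entropy of the side output, the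
conditional entropy at the mean input pmf, and an error term. -/
theorem logb_card_le (hM : 0 < M) (hn : 0 < n) (enc : Fin M → Fin n → X)
    (dec : (Fin n → Y) → Fin M) (y : X → Y) (b : X → B) :
    (1 - ∑ m, if dec (fun i => y (enc m i)) ≠ m then unif M m else 0) * Real.logb 2 M ≤
      entropy (unif M) (fun m i => b (enc m i)) + n * condEntropy (meanInput enc) y b + 1 := by
  have hM' : (0 : ℝ) < M := by positivity
  set p := meanInput enc with hp
  have hp0 : ∀ x, 0 ≤ p x := meanInput_nonneg enc
  -- Conditional pmf of `y` given `b` under `p`. Where `b` has probability zero it is identically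
  -- zero, hence only a sub-pmf.
  set q : Y × B → ℝ := fun c => law p (fun x => (y x, b x)) c / law p b c.2 with hq
  set r : (Fin n → B) → ℝ := law (unif M) (fun m i => b (enc m i)) with hr
  -- Half the mass goes to the decoded message and half is spread uniformly: the log-loss is at most
  -- 1 bit when decoding succeeds and `1 + log M` when it fails, which is Fano's bound.
  set F : (Fin n → Y) → Fin M → ℝ := fun u m => if dec u = m then 1 / 2 else 1 / (2 * M) with hF
  have hq0 : ∀ c, 0 ≤ q c := fun c => div_nonneg (law_nonneg hp0 _ _) (law_nonneg hp0 _ _)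
  have hq1 : ∀ v, ∑ a, q (a, v) ≤ 1 := by
    intro v
    simp only [hq, ← Finset.sum_div]
    rw [← law_snd p y b v]
    exact div_self_le_one _
  have hqpos : ∀ m i, 0 < q (y (enc m i), b (enc m i)) := fun m i =>
    div_pos ((meanInput_pos hM hn enc m i).trans_le (le_law hp0 (fun x => (y x, b x)) _))
      ((meanInput_pos hM hn enc m i).trans_le (le_law hp0 b _))
  have hrpos : ∀ m, 0 < r (fun i => b (enc m i)) := fun m =>
    lt_of_lt_of_le (by unfold unif; positivity)
      (le_law (unif_nonneg M) (fun m i => b (enc m i)) m)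
  have hFpos : ∀ u m, 0 < F u m := fun u m => by
    simp only [hF]; split_ifs <;> positivity
  have hprodpos : ∀ m, 0 < ∏ i, q (y (enc m i), b (enc m i)) := fun m =>
    Finset.prod_pos fun i _ => hqpos m i
  have hsum := sum_mul_mul_le_one (fun m i => b (enc m i)) (fun m i => y (enc m i))
    (r := r) (w := fun v u => ∏ i, q (u i, v i)) (F := F) (law_nonneg (unif_nonneg M) _)
    (fun v u => Finset.prod_nonneg fun i _ => hq0 _) (fun u m => (hFpos u m).le)
    (by rw [sum_law, sum_unif hM])
    (fun v => by
      rw [← Fintype.prod_sum (fun i a => q (a, v i))]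
      exact Finset.prod_le_one (fun i _ => Finset.sum_nonneg fun a _ => hq0 _) fun i _ => hq1 _)
    (fun u => sum_guess_le_one (dec u))
  have hG := sum_mul_logb_le (unif_nonneg M) (sum_unif hM)
    (fun m => (mul_pos (hrpos m) (mul_pos (hprodpos m) (hFpos _ m))).le) hsum
    (fun m _ => mul_pos (hrpos m) (mul_pos (hprodpos m) (hFpos _ m)))
  have hlog : ∀ m, Real.logb 2 (r (fun i => b (enc m i)) *
      ((∏ i, q (y (enc m i), b (enc m i))) * F (fun i => y (enc m i)) m)) =
      Real.logb 2 (r (fun i => b (enc m i))) +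
        (∑ i, Real.logb 2 (q (y (enc m i), b (enc m i))) +
          Real.logb 2 (F (fun i => y (enc m i)) m)) := by
    intro m
    rw [Real.logb_mul (hrpos m).ne' (mul_pos (hprodpos m) (hFpos _ m)).ne',
      Real.logb_mul (hprodpos m).ne' (hFpos _ m).ne', Real.logb_prod _ _ fun i _ => (hqpos m i).ne']
  have hE : entropy (unif M) (fun m i => b (enc m i)) =
      -∑ m, unif M m * Real.logb 2 (r (fun i => b (enc m i))) := entropy_eq_sum _ _
  have hC : n * condEntropy p y b =
      -∑ m, unif M m * ∑ i, Real.logb 2 (q (y (enc m i), b (enc m i))) := by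
    have hn' : (n : ℝ) ≠ 0 := by positivity
    rw [condEntropy_eq_sum hp0, sum_meanInput_mul enc (fun x => Real.logb 2 (q (y x, b x)))]
    field_simp
  have hFano : -∑ m, unif M m * Real.logb 2 (F (fun i => y (enc m i)) m) ≤
      1 + (∑ m, if dec (fun i => y (enc m i)) ≠ m then unif M m else 0) * Real.logb 2 M := by
    rw [← sum_unif hM, Finset.sum_mul, ← Finset.sum_add_distrib, ← Finset.sum_neg_distrib]
    refine Finset.sum_le_sum fun m _ => ?_
    simp only [hF]
    by_cases h : dec (fun i => y (enc m i)) = m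
    · simp [h, Real.logb_inv]
    · rw [if_neg h, if_pos h, one_div, Real.logb_inv, Real.logb_mul two_ne_zero hM'.ne',
        Real.logb_self_eq_one one_lt_two]
      linarith
  have hR : ∑ m, unif M m * Real.logb 2 (unif M m) = -Real.logb 2 M := by
    have : ∀ m, Real.logb 2 (unif M m) = -Real.logb 2 M := fun m => by
      simp [unif, Real.logb_inv]
    simp only [this]
    rw [← Finset.sum_mul, sum_unif hM, one_mul]
  simp only [hlog, mul_add, Finset.sum_add_distrib] at hG
  rw [hR] at hG
  linarith

open Classical in
-- The one-shot bound normalized by `n`; `he` allows `log M` to be replaced by its lower bound `nR`.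
theorem rate_sub_le (hM : 0 < M) (hn : 0 < n) (enc : Fin M → Fin n → X)
    (dec : (Fin n → Y) → Fin M) (y : X → Y) (b : X → B) {R D : ℝ}
    (hR : n * R ≤ Real.logb 2 M)
    (he : ∑ m, (if dec (fun i => y (enc m i)) ≠ m then unif M m else 0) ≤ 1)
    (hD : 1 / (n : ℝ) * entropy (unif M) (fun m i => b (enc m i)) ≤ D) :
    R - (∑ m, if dec (fun i => y (enc m i)) ≠ m then unif M m else 0) * R - D - 1 / (n : ℝ) ≤
      condEntropy (meanInput enc) y b := by
  have hn' : (0 : ℝ) < n := by positivity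
  have h := logb_card_le hM hn enc dec y b
  set e := ∑ m, if dec (fun i => y (enc m i)) ≠ m then unif M m else 0
  have h' := mul_le_mul_of_nonneg_left ((mul_le_mul_of_nonneg_left hR (sub_nonneg.2 he)).trans h)
    (by positivity : 0 ≤ 1 / (n : ℝ))
  have e1 : 1 / (n : ℝ) * ((1 - e) * (n * R)) = R - e * R := by field_simp
  have e2 : 1 / (n : ℝ) * (entropy (unif M) (fun m i => b (enc m i)) +
      n * condEntropy (meanInput enc) y b + 1) =
      1 / (n : ℝ) * entropy (unif M) (fun m i => b (enc m i)) +
      condEntropy (meanInput enc) y b + 1 / (n : ℝ) := by field_simp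
  rw [e1, e2] at h'
  linarith

end Converse

/-! ### The single-letter outer bound -/

section Region

variable {K : ℕ} {X Y : Type*} {Z : Fin K → Type*} [Fintype X] [Fintype Y]
  [∀ j, Fintype (Z j)]

/-- Projection along the compact simplex is a closed map. Conditional entropy is rewritten as a
difference of entropies, whose continuity involves no division. -/
theorem isClosed_singleLetterRegion (y : X → Y) (z : ∀ j, X → Z j) :
    IsClosed {t : ℝ × (Fin K → ℝ) | ∃ p ∈ stdSimplex ℝ X, t.1 ≤ entropy p y ∧
      ∀ j, t.1 - t.2 j ≤ condEntropy p y (z j)} := by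
  have : CompactSpace (stdSimplex ℝ X) := isCompact_iff_compactSpace.1 (isCompact_stdSimplex ℝ X)
  have hcl : IsClosed {s : (ℝ × (Fin K → ℝ)) × stdSimplex ℝ X | s.1.1 ≤ entropy s.2.1 y ∧
      ∀ j, s.1.1 - s.1.2 j ≤
        entropy s.2.1 (fun x => (y x, z j x)) - entropy s.2.1 (z j)} := by
    have hc : ∀ {A : Type _} [Fintype A] (f : X → A),
        Continuous fun s : (ℝ × (Fin K → ℝ)) × stdSimplex ℝ X => entropy s.2.1 f := fun f =>
      (continuous_entropy f).comp (continuous_subtype_val.comp continuous_snd)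
    have hcy : Continuous fun s : (ℝ × (Fin K → ℝ)) × stdSimplex ℝ X => entropy s.2.1 y :=
      (continuous_entropy y).comp (continuous_subtype_val.comp continuous_snd)
    have hcz : ∀ j, Continuous fun s : (ℝ × (Fin K → ℝ)) × stdSimplex ℝ X =>
        entropy s.2.1 (z j) := fun j =>
      (continuous_entropy _).comp (continuous_subtype_val.comp continuous_snd)
    simp only [Set.ofPred_and, Set.ofPred_forall]
    refine (isClosed_le (by fun_prop) hcy).inter (isClosed_iInter fun j => isClosed_le
      (by fun_prop) ((hc _).sub (hcz j)))
  convert isClosedMap_fst_of_compactSpace _ hcl using 1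
  ext t
  constructor
  · rintro ⟨p, hp, h1, h2⟩
    exact ⟨(t, ⟨p, hp⟩), ⟨h1, fun j => by
      simpa only [condEntropy_eq_sub hp.1] using h2 j⟩, rfl⟩
  · rintro ⟨⟨t, p, hp⟩, ⟨h1, h2⟩, rfl⟩
    exact ⟨p, hp, h1, fun j => by simpa only [condEntropy_eq_sub hp.1] using h2 j⟩

theorem mem_singleLetterRegion_of_achievable (y : X → Y) (z : ∀ j, X → Z j)
    {t : ℝ × (Fin K → ℝ)} (ht : Achievable (deterministicChannel y z) t) :
    ∃ p ∈ stdSimplex ℝ X, t.1 ≤ entropy p y ∧ ∀ j, t.1 - t.2 j ≤ condEntropy p y (z j) := by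
  classical
  obtain ⟨hR, -, c, hc, hd⟩ := ht
  have hlim : Tendsto (fun δ : ℝ => (t.1 - δ, t.2)) (𝓝[>] 0) (𝓝 t) := by
    have : Tendsto (fun δ : ℝ => (t.1 - δ, t.2)) (𝓝 0) (𝓝 (t.1 - 0, t.2)) :=
      Continuous.tendsto (by fun_prop) 0
    rw [sub_zero] at this
    exact this.mono_left nhdsWithin_le_nhds
  refine (isClosed_singleLetterRegion y z).mem_of_tendsto hlim ?_
  filter_upwards [self_mem_nhdsWithin] with δ (hδ : 0 < δ)
  -- The slack `δ` is shared equally among the error term, the `1/n` term and the excess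
  -- disturbance.
  have hev1 : ∀ᶠ n in atTop, (c n).errorProb (deterministicChannel y z) * t.1 < δ / 3 := by
    have := hc.mul_const t.1
    rw [zero_mul] at this
    exact this.eventually_lt_const (by positivity)
  have hev2 : ∀ᶠ n : ℕ in atTop, 1 / (n : ℝ) < δ / 3 :=
    tendsto_one_div_atTop_nhds_zero_nat.eventually_lt_const (by positivity)
  have hev3 : ∀ᶠ n in atTop, ∀ j,
      (c n).disturbance (deterministicChannel y z) j < t.2 j + δ / 3 := by
    rw [eventually_all]
    intro j
    have : limsup (fun n => (((c n).disturbance (deterministicChannel y z) j : ℝ) : EReal)) atTop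
        < ((t.2 j + δ / 3 : ℝ) : EReal) :=
      (hd j).trans_lt (EReal.coe_lt_coe_iff.2 (by linarith))
    filter_upwards [eventually_lt_of_limsup_lt this] with n hn
    exact EReal.coe_lt_coe_iff.1 hn
  have hev4 : ∀ᶠ n in atTop, (c n).errorProb (deterministicChannel y z) < 1 :=
    hc.eventually_lt_const one_pos
  obtain ⟨n, h1, h2, h3, h4, hn⟩ :=
    (hev1.and (hev2.and (hev3.and (hev4.and (eventually_gt_atTop 0))))).exists
  have hM := numMessages_pos t.1 n
  have hp := meanInput_mem_stdSimplex hM hn (c n).enc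
  have hE := (c n).errorProb_deterministic y z
  refine ⟨meanInput (c n).enc, hp, ?_, fun j => ?_⟩
  -- A constant side output has no entropy and turns the general bound into `R ≤ H(Y)`.
  · have := rate_sub_le hM hn (c n).enc (c n).dec y (fun _ => ()) (D := 0)
      (mul_le_logb_numMessages _ _) (by rw [← hE]; exact h4.le) (by
      rw [entropy_const (sum_unif hM) (fun _ => ()), mul_zero])
    rw [condEntropy_const hp.1 hp.2, ← hE] at this
    linarith
  · have := rate_sub_le hM hn (c n).enc (c n).dec y (z j) (D := t.2 j + δ / 3)
      (mul_le_logb_numMessages _ _) (by rw [← hE]; exact h4.le) (by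
      rw [← (c n).disturbance_deterministic y z j]
      exact (h3 j).le)
    rw [← hE] at this
    linarith

end Region

/-! ### Covering orbits by translates -/

section Covering

open MulAction
open scoped Nat

variable {G T : Type*} [Group G] [MulAction G T]

/-- The solutions `g` form a coset of the stabilizer of `c`; orbit–stabilizer counts them. -/
theorem card_filter_smul_eq_mul_ncard_orbit [Fintype G] [DecidableEq T] {c v t : T}
    (hc : c ∈ orbit G t) (hv : v ∈ orbit G t) :
    (Finset.univ.filter fun g : G => g • c = v).card * (orbit G t).ncard = Fintype.card G := by
  rw [← orbit_eq_iff.2 hc] at hv ⊢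
  obtain ⟨g₀, rfl⟩ := hv
  rw [← index_stabilizer, ← Nat.card_eq_fintype_card, ← (stabilizer G c).card_mul_index]
  congr 1
  rw [← Fintype.card_subtype, ← Nat.card_eq_fintype_card]
  refine Nat.card_congr ((Equiv.mulLeft g₀⁻¹).subtypeEquiv fun g => ?_)
  simp [MulAction.mem_stabilizer_iff, mul_smul, inv_smul_eq_iff]

/-- Averaging over `g`: each pair `(c, v)` is matched by the same number `|G| / |orbit|` of
elements, so the mean intersection has size `|C| |V| / |orbit|`, and some `g` attains at least the
mean. -/
theorem exists_mul_card_le_card_inter_image_smul [Fintype G] [DecidableEq T] {C V : Finset T}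
    {t : T} (hC : ∀ c ∈ C, c ∈ orbit G t) (hV : ∀ v ∈ V, v ∈ orbit G t) :
    ∃ g : G, C.card * V.card ≤ (V ∩ C.image (g • ·)).card * (orbit G t).ncard := by
  by_contra! h
  have hlt := Finset.sum_lt_sum_of_nonempty (Finset.univ_nonempty (α := G)) fun g _ => h g
  refine hlt.ne ?_
  have hcard : ∀ g : G, (V ∩ C.image (g • ·)).card =
      ∑ c ∈ C, ∑ v ∈ V, if g • c = v then 1 else 0 := by
    intro g
    simp only [Finset.sum_ite_eq, Finset.sum_boole, Nat.cast_id]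
    rw [← Finset.card_image_of_injective (C.filter fun c => g • c ∈ V) (MulAction.injective g)]
    congr 1
    ext v
    simp only [Finset.mem_inter, Finset.mem_image, Finset.mem_filter]
    constructor
    · rintro ⟨hv, c, hc, rfl⟩
      exact ⟨c, ⟨hc, hv⟩, rfl⟩
    · rintro ⟨c, ⟨hc, hv⟩, rfl⟩
      exact ⟨hv, c, hc, rfl⟩
  calc ∑ g : G, (V ∩ C.image (g • ·)).card * (orbit G t).ncard
      = ∑ c ∈ C, ∑ v ∈ V,
        (Finset.univ.filter fun g : G => g • c = v).card * (orbit G t).ncard := by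
        rw [← Finset.sum_mul]
        simp only [hcard]
        rw [Finset.sum_comm, Finset.sum_mul]
        refine Finset.sum_congr rfl fun c _ => ?_
        rw [Finset.sum_comm, Finset.sum_mul]
        simp
    _ = ∑ c ∈ C, ∑ v ∈ V, Fintype.card G := Finset.sum_congr rfl fun c hc =>
        Finset.sum_congr rfl fun v hv => card_filter_smul_eq_mul_ncard_orbit (hC c hc) (hV v hv)
    _ = ∑ g : G, C.card * V.card := by simp; ring

/-- Greedy covering of an orbit by translates of one of its subsets. -/
theorem exists_min_le_two_mul_card_biUnion_smul [Fintype G] [Finite T] [DecidableEq T]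
    {C : Finset T} {t : T} (hC : ∀ c ∈ C, c ∈ orbit G t) (k : ℕ) :
    ∃ S : Finset G, S.card ≤ k ∧ min (orbit G t).ncard (k * C.card) ≤
      2 * (S.biUnion fun g => C.image (g • ·)).card := by
  classical
  induction k with
  | zero => exact ⟨∅, by simp⟩
  | succ k ih =>
    obtain ⟨S, hS, h⟩ := ih
    set U := S.biUnion fun g => C.image (g • ·) with hU
    -- Once half the orbit is covered, nothing more need be added.
    by_cases hbig : (orbit G t).ncard ≤ 2 * U.card
    · exact ⟨S, by omega, min_le_of_left_le hbig⟩
    rw [min_le_iff, or_iff_right hbig] at h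
    have hfin : (orbit G t).Finite := Set.toFinite _
    set V := hfin.toFinset \ U with hVdef
    obtain ⟨g, hg⟩ := exists_mul_card_le_card_inter_image_smul (V := V) hC (fun v hv => by
      simpa using (Finset.mem_sdiff.1 hv).1)
    have hsub : U ⊆ hfin.toFinset := by
      intro u hu
      simp only [hU, Finset.mem_biUnion, Finset.mem_image] at hu
      obtain ⟨g', -, c, hc, rfl⟩ := hu
      simpa using (mem_orbit_of_mem_orbit g' (hC c hc))
    have hVcard : V.card + U.card = (orbit G t).ncard := by
      rw [hVdef, Finset.card_sdiff_add_card_eq_card hsub, Set.ncard_eq_toFinset_card _ hfin]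
    refine ⟨insert g S, (Finset.card_insert_le _ _).trans (by omega), min_le_of_right_le ?_⟩
    have hunion : U.card + (V ∩ C.image (g • ·)).card ≤
        ((insert g S).biUnion fun g => C.image (g • ·)).card := by
      rw [← Finset.card_union_of_disjoint]
      · refine Finset.card_le_card ?_
        rw [Finset.biUnion_insert]
        exact Finset.union_subset Finset.subset_union_right
          (Finset.inter_subset_right.trans Finset.subset_union_left)
      · exact Finset.disjoint_sdiff.mono_right Finset.inter_subset_left
    -- The uncovered part `V` is still at least half the orbit, so the chosen translate contributes
    -- at least `|C| / 2` new points.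
    have hgain : C.card ≤ 2 * (V ∩ C.image (g • ·)).card := by
      by_contra! hlt
      have hO : 0 < (orbit G t).ncard := by omega
      have : C.card * (orbit G t).ncard < C.card * (orbit G t).ncard := by
        calc C.card * (orbit G t).ncard ≤ C.card * (2 * V.card) := by gcongr; omega
          _ = 2 * (C.card * V.card) := by ring
          _ ≤ 2 * ((V ∩ C.image (g • ·)).card * (orbit G t).ncard) := by gcongr
          _ = 2 * (V ∩ C.image (g • ·)).card * (orbit G t).ncard := by ring
          _ < C.card * (orbit G t).ncard := by gcongr
      exact lt_irrefl _ this
    calc (k + 1) * C.card = k * C.card + C.card := by ring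
      _ ≤ 2 * U.card + 2 * (V ∩ C.image (g • ·)).card := by gcongr
      _ ≤ _ := by omega

/-- Two-level covering of an orbit along a chain of subgroups `H₁ ≤ H₂`. -/
theorem exists_two_level_cover [Finite G] [Finite T] {H₁ H₂ : Subgroup G} (hH : H₁ ≤ H₂) (t : T)
    (k m : ℕ) :
    ∃ (C : Finset T) (S₂ S₁ : Finset G), S₂.card ≤ k ∧ S₁.card ≤ m ∧ (∀ h ∈ S₁, h ∈ H₂) ∧
      (∀ c ∈ C, ∃ g ∈ S₂, ∃ h ∈ S₁, ∃ s ∈ H₁, c = (g * h * s) • t) ∧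
      min (orbit G t).ncard (k * min (orbit H₂ t).ncard (m * (orbit H₁ t).ncard)) ≤
        4 * C.card := by
  classical
  cases nonempty_fintype G
  have hfin : (orbit H₁ t).Finite := Set.toFinite _
  -- Inner level: translates by `H₂` of the `H₁`-orbit. The outer level then translates the
  -- resulting set by `G`; each level loses a factor 2.
  obtain ⟨S₁, hS₁, h₁⟩ := exists_min_le_two_mul_card_biUnion_smul (G := H₂) (C := hfin.toFinset)
    (t := t) (fun c hc => by
      obtain ⟨s, rfl⟩ := (Set.Finite.mem_toFinset hfin).1 hc
      exact ⟨⟨s.1, hH s.2⟩, rfl⟩) m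
  rw [← Set.ncard_eq_toFinset_card _ hfin] at h₁
  set C₁ := S₁.biUnion fun g => hfin.toFinset.image (g • ·) with hC₁
  have hmem : ∀ c ∈ C₁, ∃ h ∈ S₁, ∃ s ∈ H₁, c = (h.1 * s) • t := by
    intro c hc
    simp only [hC₁, Finset.mem_biUnion, Finset.mem_image, Set.Finite.mem_toFinset] at hc
    obtain ⟨h, hh, _, ⟨s, rfl⟩, rfl⟩ := hc
    exact ⟨h, hh, s.1, s.2, (mul_smul h.1 s.1 t).symm⟩
  obtain ⟨S₂, hS₂, h₂⟩ := exists_min_le_two_mul_card_biUnion_smul (G := G) (C := C₁)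
    (t := t) (fun c hc => by
      obtain ⟨h, -, s, -, rfl⟩ := hmem c hc
      exact mem_orbit _ _) k
  refine ⟨S₂.biUnion fun g => C₁.image (g • ·), S₂, S₁.map (Function.Embedding.subtype _), hS₂,
    by simpa using hS₁, ?_, ?_, ?_⟩
  · intro h hh
    obtain ⟨h', -, rfl⟩ := Finset.mem_map.1 hh
    exact h'.2
  · intro c hc
    obtain ⟨g, hg, hc⟩ := Finset.mem_biUnion.1 hc
    obtain ⟨c', hc', rfl⟩ := Finset.mem_image.1 hc
    obtain ⟨h, hh, s, hs, rfl⟩ := hmem c' hc'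
    exact ⟨g, hg, h.1, Finset.mem_map_of_mem _ hh, s, hs, by simp only [mul_assoc, mul_smul]⟩
  · calc _ ≤ min (orbit G t).ncard (k * (2 * C₁.card)) := by gcongr
      _ ≤ 2 * min (orbit G t).ncard (k * C₁.card) := by
          rw [mul_left_comm]
          omega
      _ ≤ 2 * (2 * _) := by gcongr
      _ = _ := by ring

/-- The product of the factorials of the fibre sizes of `f`. -/
def fibreFactorial {α B : Type*} [Fintype α] [Fintype B] (f : α → B) : ℕ :=
  ∏ b, (Nat.card {a // f a = b})!

open DomMulAct

variable {α B D : Type*} [Fintype α] [Fintype B] [Fintype D]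

theorem card_stabilizer_eq_fibreFactorial (f : α → B) :
    Nat.card (stabilizer (Equiv.Perm α)ᵈᵐᵃ f) = fibreFactorial f := by
  classical
  rw [fibreFactorial]
  simp only [Nat.card_eq_fintype_card]
  rw [← DomMulAct.stabilizer_card f, ← Nat.card_eq_fintype_card]
  exact (Nat.card_congr (Equiv.subtypeEquiv mk fun _ => Iff.rfl)).symm

/-- Orbit–stabilizer inside the stabilizer of `b`: a permutation fixing both `b` and `t` is one
fixing the pair. -/
theorem ncard_orbit_stabilizer_mul_fibreFactorial (b : α → B) (t : α → D) :
    (orbit (stabilizer (Equiv.Perm α)ᵈᵐᵃ b) t).ncard * fibreFactorial (fun i => (t i, b i)) =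
      fibreFactorial b := by
  rw [← card_stabilizer_eq_fibreFactorial b, ← card_stabilizer_eq_fibreFactorial,
    ← index_stabilizer, ← (stabilizer (stabilizer (Equiv.Perm α)ᵈᵐᵃ b) t).index_mul_card]
  congr 1
  refine (Nat.card_congr ?_).symm
  refine (Equiv.subtypeSubtypeEquivSubtypeInter (fun g => g ∈ stabilizer (Equiv.Perm α)ᵈᵐᵃ b)
    (fun g => g ∈ stabilizer (Equiv.Perm α)ᵈᵐᵃ t)).trans (Equiv.subtypeEquivRight fun g => ?_)
  simp only [MulAction.mem_stabilizer_iff, funext_iff, ← forall_and]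
  exact forall_congr' fun i => by rw [and_comm]; exact Prod.mk.injEq _ _ _ _ ▸ Iff.rfl

/-- Many output sequences can be reached by inputs whose side outputs take few values. -/
theorem exists_finset_outputs {X Y A B : Type*} [Fintype Y] {n : ℕ} (x : Fin n → X) (y : X → Y)
    (a : X → A) (b : X → B) (hab : Refines a b) (k m : ℕ) :
    ∃ (C : Finset (Fin n → Y)) (Wa : Finset (Fin n → A)) (Wb : Finset (Fin n → B)),
      Wa.card ≤ k * m ∧ Wb.card ≤ k ∧
      (∀ c ∈ C, ∃ u : Fin n → X, (fun i => y (u i)) = c ∧ (fun i => a (u i)) ∈ Wa ∧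
        (fun i => b (u i)) ∈ Wb) ∧
      min (orbit (Equiv.Perm (Fin n))ᵈᵐᵃ fun i => y (x i)).ncard
        (k * min (orbit (stabilizer (Equiv.Perm (Fin n))ᵈᵐᵃ fun i => b (x i))
            fun i => y (x i)).ncard
          (m * (orbit (stabilizer (Equiv.Perm (Fin n))ᵈᵐᵃ fun i => a (x i))
            fun i => y (x i)).ncard)) ≤ 4 * C.card := by
  classical
  have : Finite (Equiv.Perm (Fin n))ᵈᵐᵃ := Finite.of_equiv _ DomMulAct.mk
  have hH : stabilizer (Equiv.Perm (Fin n))ᵈᵐᵃ (fun i => a (x i)) ≤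
      stabilizer (Equiv.Perm (Fin n))ᵈᵐᵃ fun i => b (x i) := by
    intro g hg
    rw [MulAction.mem_stabilizer_iff, funext_iff] at hg ⊢
    exact fun i => hab (hg i)
  obtain ⟨C, S₂, S₁, h₂, h₁, hS₁, hC, hmin⟩ := exists_two_level_cover hH (fun i => y (x i)) k m
  -- For the input `(g * h * s) • x`, `s` fixes `a(x)` and both `h` and `s` fix `b(x)`; the side
  -- outputs thus depend only on `(g, h)` and on `g`.
  refine ⟨C, (S₂ ×ˢ S₁).image fun s => (s.1 * s.2) • fun i => a (x i),
    S₂.image fun s => s • fun i => b (x i), ?_, Finset.card_image_le.trans h₂, ?_, hmin⟩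
  · refine Finset.card_image_le.trans ?_
    rw [Finset.card_product]
    gcongr
  · intro c hc
    obtain ⟨g, hg, h, hh, s, hs, rfl⟩ := hC c hc
    refine ⟨(g * h * s) • x, rfl, ?_, ?_⟩
    · refine Finset.mem_image.2 ⟨(g, h), Finset.mk_mem_product hg hh, ?_⟩
      change (g * h) • (fun i => a (x i)) = (g * h * s) • fun i => a (x i)
      rw [mul_smul _ s, MulAction.mem_stabilizer_iff.1 hs]
    · refine Finset.mem_image.2 ⟨g, hg, ?_⟩
      change g • (fun i => b (x i)) = (g * h * s) • fun i => b (x i)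
      rw [mul_smul _ s, MulAction.mem_stabilizer_iff.1 (hH hs), mul_smul,
        MulAction.mem_stabilizer_iff.1 (hS₁ h hh)]

end Covering

/-! ### Exponential growth of orbits -/

section FactorialAsymptotics

open scoped Nat
open MulAction

/-- With `log_factorial_le`, a weak Stirling formula: the two bounds differ by `log n + 1`, which is
`o(n)`. -/
theorem mul_log_sub_le_log_factorial (n : ℕ) : n * Real.log n - n ≤ Real.log (n ! : ℝ) := by
  induction n with
  | zero => simp
  | succ n ih =>
    rw [Nat.factorial_succ, Nat.cast_mul, Real.log_mul (by positivity) (by positivity)]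
    rcases n.eq_zero_or_pos with rfl | hn
    · simp
    have hn' : (0 : ℝ) < n := by exact_mod_cast hn
    have h := Real.log_le_sub_one_of_pos (x := ((n + 1 : ℕ) : ℝ) / n) (by positivity)
    rw [Real.log_div (by positivity) (by positivity)] at h
    have h' := mul_le_mul_of_nonneg_left h hn'.le
    have e : (n : ℝ) * (((n + 1 : ℕ) : ℝ) / n - 1) = 1 := by
      push_cast; field_simp; ring
    rw [e] at h'
    push_cast at h' ⊢
    linarith

theorem log_factorial_le {n : ℕ} (hn : 1 ≤ n) :
    Real.log (n ! : ℝ) ≤ n * Real.log n - n + (Real.log n + 1) := by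
  induction n, hn using Nat.le_induction with
  | base => simp
  | succ n hn ih =>
    rw [Nat.factorial_succ, Nat.cast_mul, Real.log_mul (by positivity) (by positivity)]
    have hn' : (0 : ℝ) < n := by exact_mod_cast hn
    have h := Real.one_sub_inv_le_log_of_pos (x := ((n + 1 : ℕ) : ℝ) / n) (by positivity)
    rw [Real.log_div (by positivity) (by positivity)] at h
    have h' := mul_le_mul_of_nonneg_left h (by positivity : (0 : ℝ) ≤ n + 1)
    have e : ((n : ℝ) + 1) * (1 - (((n + 1 : ℕ) : ℝ) / n)⁻¹) = 1 := by
      push_cast; field_simp; ring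
    rw [e] at h'
    push_cast at h' ⊢
    linarith

/-- Centring with `log n` instead of `log (m n)` lets the corrections add up over fibres. Continuity
of `x log x` at `0` covers `q = 0`, where `m n` may stay bounded. -/
theorem tendsto_log_factorial_of_div {m : ℕ → ℕ} {q : ℝ} (hm : ∀ n, m n ≤ n)
    (hq : Tendsto (fun n => (m n : ℝ) / n) atTop (𝓝 q)) :
    Tendsto (fun n : ℕ => (Real.log ((m n)! : ℝ) - m n * Real.log n + m n) / n) atTop
      (𝓝 (q * Real.log q)) := by
  have hη : Tendsto (fun n => (m n : ℝ) / n * Real.log ((m n : ℝ) / n)) atTop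
      (𝓝 (q * Real.log q)) := (Real.continuous_mul_log.tendsto q).comp hq
  have herr : Tendsto (fun n : ℕ => (Real.log n + 1) / (n : ℝ)) atTop (𝓝 0) := by
    have h1 : Tendsto (fun n : ℕ => Real.log n / (n : ℝ)) atTop (𝓝 0) :=
      (Real.isLittleO_log_id_atTop.tendsto_div_nhds_zero).comp tendsto_natCast_atTop_atTop
    simpa [add_div] using h1.add tendsto_one_div_atTop_nhds_zero_nat
  have key : ∀ n : ℕ, 0 < n → (m n : ℝ) / n * Real.log ((m n : ℝ) / n) =
      (m n * Real.log (m n) - m n * Real.log n) / n := by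
    intro n hn
    rcases (m n).eq_zero_or_pos with h | h
    · simp [h]
    · rw [Real.log_div (by positivity) (by positivity)]
      ring
  refine tendsto_of_tendsto_of_tendsto_of_le_of_le' hη (by simpa using hη.add herr) ?_ ?_
  · filter_upwards [eventually_gt_atTop 0] with n hn
    rw [key n hn]
    refine div_le_div_of_nonneg_right ?_ n.cast_nonneg
    linarith [mul_log_sub_le_log_factorial (m n)]
  · filter_upwards [eventually_gt_atTop 0] with n hn
    rw [key n hn, ← add_div]
    refine div_le_div_of_nonneg_right ?_ n.cast_nonneg
    have hlogn : 0 ≤ Real.log n := Real.log_natCast_nonneg n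
    rcases (m n).eq_zero_or_pos with h | h
    · simp [h]; linarith
    · have h1 := log_factorial_le h
      have h2 : Real.log (m n) ≤ Real.log n :=
        Real.log_le_log (by positivity) (by exact_mod_cast hm n)
      linarith

variable {X Y A B : Type*} [Fintype X] [Fintype Y] [Fintype A] [Fintype B]

theorem law_unif_eq {A : Type*} {n : ℕ} (f : Fin n → A) (a : A) :
    law (unif n) f a = (Nat.card {i // f i = a} : ℝ) / n := by
  classical
  rw [Nat.card_eq_fintype_card, Fintype.card_subtype]
  simp only [law, unif, ← Finset.sum_filter, Finset.sum_const, nsmul_eq_mul]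
  rw [mul_one_div]

/-- The diverging term `log n - 1` does not depend on `f`, so it cancels when two fibre factorials
are compared. -/
theorem tendsto_log_fibreFactorial {p : X → ℝ} {u : (n : ℕ) → Fin n → X}
    (hu : Tendsto (fun n => law (unif n) (u n)) atTop (𝓝 p)) (f : X → A) :
    Tendsto (fun n : ℕ => Real.log (fibreFactorial fun i => f (u n i)) / n - (Real.log n - 1))
      atTop (𝓝 (-(Real.log 2 * entropy p f))) := by
  have hl : ∀ a, Tendsto (fun n => (Nat.card {i // f (u n i) = a} : ℝ) / n) atTop
      (𝓝 (law p f a)) := by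
    intro a
    have := ((continuous_law f a).tendsto p).comp hu
    refine this.congr fun n => ?_
    simp only [Function.comp_apply, law_law]
    exact law_unif_eq (fun i => f (u n i)) a
  have hsum := tendsto_finsetSum Finset.univ fun a (_ : a ∈ Finset.univ) =>
    tendsto_log_factorial_of_div (fun n => by
      simpa using Nat.card_le_card_of_injective
        (Subtype.val : {i // f (u n i) = a} → Fin n) Subtype.val_injective) (hl a)
  have hval : ∑ a, law p f a * Real.log (law p f a) = -(Real.log 2 * entropy p f) := by
    have : Real.log 2 ≠ 0 := (Real.log_pos one_lt_two).ne'
    simp only [entropy, pmfEntropy, Real.logb, Finset.sum_neg_distrib, mul_neg, neg_neg,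
      Finset.mul_sum]
    refine Finset.sum_congr rfl fun a _ => ?_
    field_simp
  rw [hval] at hsum
  refine hsum.congr' ?_
  filter_upwards [eventually_gt_atTop 0] with n hn
  have hn' : (n : ℝ) ≠ 0 := by positivity
  have hc : ∑ a, (Nat.card {i // f (u n i) = a} : ℝ) = n := by
    have h := sum_law (unif n) (fun i => f (u n i))
    simp only [law_unif_eq, sum_unif hn, ← Finset.sum_div] at h
    rwa [div_eq_one_iff_eq hn'] at h
  rw [← Finset.sum_div, Finset.sum_add_distrib, Finset.sum_sub_distrib, ← Finset.sum_mul, hc,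
    fibreFactorial, Nat.cast_prod, Real.log_prod fun a _ => by positivity]
  field_simp
  ring

/-- The orbit is a conditional type class. Its size is a ratio of fibre factorials, with exponent
`H(Y, b) - H(b)`. -/
theorem tendsto_logb_ncard_orbit {p : X → ℝ} (hp : ∀ x, 0 ≤ p x) {u : (n : ℕ) → Fin n → X}
    (hu : Tendsto (fun n => law (unif n) (u n)) atTop (𝓝 p)) (y : X → Y) (b : X → B) :
    Tendsto (fun n : ℕ => Real.logb 2
      ((orbit (stabilizer (Equiv.Perm (Fin n))ᵈᵐᵃ fun i => b (u n i)) fun i => y (u n i)).ncard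
        : ℝ) / n) atTop (𝓝 (condEntropy p y b)) := by
  have hl : Real.log 2 ≠ 0 := (Real.log_pos one_lt_two).ne'
  have h := ((tendsto_log_fibreFactorial hu b).sub
    (tendsto_log_fibreFactorial hu (fun x => (y x, b x)))).div_const (Real.log 2)
  have e : (-(Real.log 2 * entropy p b) - -(Real.log 2 * entropy p fun x => (y x, b x))) /
      Real.log 2 = condEntropy p y b := by
    rw [condEntropy_eq_sub hp]
    field_simp
    ring
  rw [e] at h
  refine h.congr fun n => ?_
  have hpos : ∀ {A : Type _} [Fintype A] (f : Fin n → A), 0 < fibreFactorial f := fun f =>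
    Finset.prod_pos fun _ _ => Nat.factorial_pos _
  have hpos' : 0 < fibreFactorial fun i => b (u n i) :=
    Finset.prod_pos fun _ _ => Nat.factorial_pos _
  have hm := ncard_orbit_stabilizer_mul_fibreFactorial (fun i => b (u n i)) (fun i => y (u n i))
  rw [← hm] at hpos' ⊢
  have ho := pos_of_mul_pos_left hpos' (Nat.zero_le _)
  rw [Nat.cast_mul, Real.log_mul (by positivity) (by exact_mod_cast (hpos _).ne'), Real.logb]
  ring

/-- A constant side output is fixed by every permutation, so this is the case of trivial
conditioning. -/
theorem tendsto_logb_ncard_orbit_top {p : X → ℝ} (hp : p ∈ stdSimplex ℝ X)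
    {u : (n : ℕ) → Fin n → X} (hu : Tendsto (fun n => law (unif n) (u n)) atTop (𝓝 p))
    (y : X → Y) :
    Tendsto (fun n : ℕ => Real.logb 2
      ((orbit (Equiv.Perm (Fin n))ᵈᵐᵃ fun i => y (u n i)).ncard : ℝ) / n) atTop
      (𝓝 (entropy p y)) := by
  rw [← condEntropy_const hp.1 hp.2 y ()]
  refine (tendsto_logb_ncard_orbit hp.1 hu y fun _ => ()).congr fun n => ?_
  congr 4
  ext v
  constructor
  · rintro ⟨g, rfl⟩
    exact ⟨g.1, rfl⟩
  · rintro ⟨g, rfl⟩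
    exact ⟨⟨g, rfl⟩, rfl⟩

theorem exists_sequence_card_fibre_ge [Nonempty X] {n : ℕ} (c : X → ℕ) (hc : ∑ x, c x ≤ n) :
    ∃ u : Fin n → X, ∀ x, c x ≤ Nat.card {i // u i = x} := by
  obtain ⟨e⟩ : Nonempty ((Σ x, Fin (c x)) ↪ Fin n) :=
    Function.Embedding.nonempty_of_card_le (by simpa using hc)
  refine ⟨Function.extend e Sigma.fst fun _ => Classical.arbitrary X, fun x => ?_⟩
  have h := Nat.card_le_card_of_injective
    (fun k : Fin (c x) => (⟨e ⟨x, k⟩, e.injective.extend_apply _ _ _⟩ :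
      {i // Function.extend e Sigma.fst (fun _ => Classical.arbitrary X) i = x}))
    (fun k l hkl => by simpa using hkl)
  simpa using h

/-- Every pmf is the limit of empirical pmfs of sequences of length `n`. -/
theorem exists_tendsto_law_unif {p : X → ℝ} (hp : p ∈ stdSimplex ℝ X) :
    ∃ u : (n : ℕ) → Fin n → X, Tendsto (fun n => law (unif n) (u n)) atTop (𝓝 p) := by
  classical
  have hX : Nonempty X := by
    by_contra h
    rw [not_nonempty_iff] at h
    simpa using hp.2
  have hsum : ∀ n : ℕ, ∑ x, ⌊n * p x⌋₊ ≤ n := by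
    intro n
    have : ((∑ x, ⌊n * p x⌋₊ : ℕ) : ℝ) ≤ n := by
      rw [Nat.cast_sum]
      calc _ ≤ ∑ x, n * p x := Finset.sum_le_sum fun x _ =>
            Nat.floor_le (mul_nonneg n.cast_nonneg (hp.1 x))
        _ = n := by rw [← Finset.mul_sum, hp.2, mul_one]
    exact_mod_cast this
  choose u hu using fun n : ℕ => exists_sequence_card_fibre_ge (fun x => ⌊n * p x⌋₊) (hsum n)
  refine ⟨u, tendsto_pi_nhds.2 fun x => ?_⟩
  -- Lower bounds suffice: both pmfs sum to 1, so the bounds at the other letters bound the law at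
  -- `x` from above.
  have hlow : ∀ n : ℕ, 0 < n → ∀ x, p x - 1 / n ≤ law (unif n) (u n) x := by
    intro n hn x
    have hn' : (0 : ℝ) < n := by exact_mod_cast hn
    rw [law_unif_eq, le_div_iff₀ hn', sub_mul, one_div_mul_cancel hn'.ne']
    have h1 := Nat.lt_floor_add_one (n * p x)
    have h2 : (⌊n * p x⌋₊ : ℝ) ≤ Nat.card {i // u n i = x} := by exact_mod_cast hu n x
    linarith
  have hinv : Tendsto (fun n : ℕ => 1 / (n : ℝ)) atTop (𝓝 0) :=
    tendsto_one_div_atTop_nhds_zero_nat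
  refine tendsto_of_tendsto_of_tendsto_of_le_of_le' (g := fun n : ℕ => p x - 1 / (n : ℝ))
    (h := fun n : ℕ => p x + (Fintype.card X) * (1 / (n : ℝ))) (by simpa using hinv.const_sub (p x))
    (by simpa using (hinv.const_mul (Fintype.card X : ℝ)).const_add (p x)) ?_ ?_
  · filter_upwards [eventually_gt_atTop 0] with n hn using hlow n hn x
  · filter_upwards [eventually_gt_atTop 0] with n hn
    have h1 : ∑ x, law (unif n) (u n) x = 1 := by rw [sum_law, sum_unif hn]
    have h2 : ∑ x' ∈ Finset.univ.erase x, (p x' - 1 / n) ≤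
        ∑ x' ∈ Finset.univ.erase x, law (unif n) (u n) x' :=
      Finset.sum_le_sum fun x' _ => hlow n hn x'
    have h3 := Finset.add_sum_erase _ p (Finset.mem_univ x)
    have h4 := Finset.add_sum_erase _ (law (unif n) (u n)) (Finset.mem_univ x)
    rw [Finset.sum_sub_distrib, Finset.sum_const, nsmul_eq_mul,
      Finset.card_erase_of_mem (Finset.mem_univ x), Finset.card_univ] at h2
    have h5 : ((Fintype.card X - 1 : ℕ) : ℝ) * (1 / n) ≤ Fintype.card X * (1 / n) := by
      gcongr
      exact Nat.sub_le _ _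
    have h6 := hp.2
    linarith

end FactorialAsymptotics

/-! ### Code construction and achievability -/

section Achievability

open MulAction

variable {K : ℕ} {X Y : Type*} {Z : Fin K → Type*} [Fintype X] [Fintype Y]
  [∀ j, Fintype (Z j)]

theorem numMessages_le_two_mul {R : ℝ} (hR : 0 ≤ R) (n : ℕ) :
    (numMessages R n : ℝ) ≤ 2 * 2 ^ (n * R) := by
  have h1 := Nat.ceil_lt_add_one (Real.rpow_nonneg zero_le_two (n * R))
  have h2 := Real.one_le_rpow one_le_two (by positivity : 0 ≤ n * R)
  unfold numMessages
  linarith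

/-- One codeword per chosen output makes message-to-output injective, hence decoding exact; the side
output then takes values in `W j`, which bounds its entropy. -/
theorem exists_code {n : ℕ} {R : ℝ} (y : X → Y) (z : ∀ j, X → Z j) (C : Finset (Fin n → Y))
    (W : ∀ j, Finset (Fin n → Z j)) (hC : numMessages R n ≤ C.card)
    (hW : ∀ c ∈ C, ∃ u : Fin n → X, (fun i => y (u i)) = c ∧ ∀ j, (fun i => z j (u i)) ∈ W j) :
    ∃ c : Code X Y R n, c.errorProb (deterministicChannel y z) = 0 ∧
      ∀ j, c.disturbance (deterministicChannel y z) j ≤ 1 / n * Real.logb 2 (W j).card := by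
  classical
  obtain ⟨e⟩ : Nonempty (Fin (numMessages R n) ↪ C) :=
    Function.Embedding.nonempty_of_card_le (by simpa using hC)
  choose u hu hu' using fun m => hW (e m) (e m).2
  have hinj : Function.Injective fun m i => y (u m i) := by
    intro m m' h
    refine e.injective (Subtype.ext ?_)
    rw [← hu m, ← hu m']
    exact h
  have : Nonempty (Fin (numMessages R n)) := ⟨⟨0, numMessages_pos R n⟩⟩
  refine ⟨⟨u, Function.invFun fun m i => y (u m i)⟩, ?_, fun j => ?_⟩
  · rw [Code.errorProb_deterministic]
    refine Finset.sum_eq_zero fun m _ => if_neg (not_not.2 ?_)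
    exact Function.leftInverse_invFun hinj m
  · rw [Code.disturbance_deterministic]
    gcongr
    exact entropy_le_logb_card (unif_nonneg _) (sum_unif (numMessages_pos R n)) _ (W j)
      fun m _ => hu' m j

theorem achievable_of_eventually_exists_code [Nonempty X] {W : Channel K X Y Z}
    {t : ℝ × (Fin K → ℝ)} (h₁ : 0 ≤ t.1) (h₂ : ∀ j, 0 ≤ t.2 j) {D : ℕ → Fin K → ℝ}
    (hD : ∀ j, Tendsto (fun n => D n j) atTop (𝓝 (t.2 j)))
    (h : ∀ᶠ n in atTop, ∃ c : Code X Y t.1 n, c.errorProb W = 0 ∧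
      ∀ j, c.disturbance W j ≤ D n j) : Achievable W t := by
  classical
  refine ⟨h₁, h₂, fun n => if hn : ∃ c : Code X Y t.1 n, c.errorProb W = 0 ∧
    ∀ j, c.disturbance W j ≤ D n j then hn.choose else
      ⟨fun _ _ => Classical.arbitrary X, fun _ => ⟨0, numMessages_pos t.1 n⟩⟩, ?_, fun j => ?_⟩
  · refine tendsto_const_nhds.congr' ?_
    filter_upwards [h] with n hn
    rw [dif_pos hn]
    exact hn.choose_spec.1.symm
  · have hlim : Tendsto (fun n => (D n j : EReal)) atTop (𝓝 (t.2 j : EReal)) :=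
      (continuous_coe_real_ereal.tendsto _).comp (hD j)
    rw [← hlim.limsup_eq]
    refine limsup_le_limsup ?_
    filter_upwards [h] with n hn
    rw [dif_pos hn]
    exact EReal.coe_le_coe_iff.2 (hn.choose_spec.2 j)

/-- Handled separately because at rate zero no positive `δ` can be subtracted; a single constant
codeword causes no disturbance. -/
theorem achievable_rate_zero [Nonempty X] (y : X → Y) (z : ∀ j, X → Z j) {d : Fin K → ℝ}
    (hd : ∀ j, 0 ≤ d j) : Achievable (deterministicChannel y z) (0, d) := by
  refine achievable_of_eventually_exists_code le_rfl hd (D := fun _ => d)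
    (fun j => tendsto_const_nhds) (Eventually.of_forall fun n => ?_)
  obtain ⟨c, hc, hc'⟩ := exists_code (R := 0) y z {fun _ : Fin n => y (Classical.arbitrary X)}
    (fun j => {fun _ => z j (Classical.arbitrary X)}) (by simp [numMessages])
    (fun c hc => ⟨fun _ => Classical.arbitrary X, (Finset.mem_singleton.1 hc).symm, fun j => by
      simp⟩)
  exact ⟨c, hc, fun j => (hc' j).trans (by simpa using hd j)⟩

/-- Fixing `a(x)` forces fixing `b(x)`, so one orbit contains the other; the inequality is the limit
of the comparison of their sizes. -/
theorem condEntropy_le_of_refines {A B : Type*} [Fintype A] [Fintype B] {p : X → ℝ}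
    (hp : p ∈ stdSimplex ℝ X) (y : X → Y) {a : X → A} {b : X → B} (hab : Refines a b) :
    condEntropy p y a ≤ condEntropy p y b := by
  obtain ⟨u, hu⟩ := exists_tendsto_law_unif hp
  refine le_of_tendsto_of_tendsto' (tendsto_logb_ncard_orbit hp.1 hu y a)
    (tendsto_logb_ncard_orbit hp.1 hu y b) fun n => ?_
  gcongr
  · exact one_lt_two
  · exact_mod_cast (Set.ncard_pos (Set.toFinite _)).2 (nonempty_orbit _)
  · exact Set.toFinite _
  · rintro _ ⟨g, rfl⟩
    refine ⟨⟨g.1, ?_⟩, rfl⟩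
    have hg := g.2
    rw [MulAction.mem_stabilizer_iff, funext_iff] at hg ⊢
    exact fun i => hab (hg i)

theorem eventually_rpow_le_of_tendsto_logb_div {N : ℕ → ℕ} (hN : ∀ n, 0 < N n) {H r : ℝ}
    (h : Tendsto (fun n => Real.logb 2 (N n) / n) atTop (𝓝 H)) (hr : r < H) :
    ∀ᶠ n : ℕ in atTop, (2 : ℝ) ^ (n * r) ≤ N n := by
  filter_upwards [h.eventually_const_lt hr, eventually_gt_atTop 0] with n hn hn0
  rw [← Real.le_logb_iff_rpow_le one_lt_two (by exact_mod_cast hN n)]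
  rw [lt_div_iff₀ (by positivity)] at hn
  linarith

theorem ncard_orbit_pos {G T : Type*} [Group G] [MulAction G T] [Finite T] (t : T) :
    0 < (orbit G t).ncard := (Set.ncard_pos (Set.toFinite _)).2 (nonempty_orbit _)

/-- Codes of rate slightly below the single-letter bounds, for two nested side outputs. -/
theorem eventually_exists_outputs {A B : Type*} [Fintype A] [Fintype B] {p : X → ℝ}
    (hp : p ∈ stdSimplex ℝ X) (y : X → Y) {a : X → A} {b : X → B} (hab : Refines a b)
    {R δ da db : ℝ} (hδ : 0 < δ) (hδR : δ ≤ R) (hda : 0 ≤ da) (hdb : 0 ≤ db)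
    (hy : R ≤ entropy p y) (ha : R - da ≤ condEntropy p y a) (hb : R - db ≤ condEntropy p y b) :
    ∀ᶠ n in atTop, ∃ (C : Finset (Fin n → Y)) (Wa : Finset (Fin n → A))
      (Wb : Finset (Fin n → B)), numMessages (R - δ) n ≤ C.card ∧
      (Wa.card : ℝ) ≤ 2 ^ (2 + n * da) ∧ (Wb.card : ℝ) ≤ 2 ^ (2 + n * db) ∧
      ∀ c ∈ C, ∃ u : Fin n → X, (fun i => y (u i)) = c ∧ (fun i => a (u i)) ∈ Wa ∧
        (fun i => b (u i)) ∈ Wb := by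
  obtain ⟨u, hu⟩ := exists_tendsto_law_unif hp
  -- The exponent of `k`: it may not exceed `db`, and `da - d`, the exponent of `m`, must be
  -- nonnegative.
  set d := min da db with hd
  have hd0 : 0 ≤ d := le_min hda hdb
  have hda' : 0 ≤ da - d := sub_nonneg.2 (min_le_left _ _)
  -- When `d = da`, the constraint for `a` implies this one, since the coarser `b` leaves more
  -- uncertainty about `y`.
  have hbd : R - d ≤ condEntropy p y b := by
    rcases min_choice da db with h | h
    · rw [hd, h]
      exact ha.trans (condEntropy_le_of_refines hp y hab)
    · rwa [hd, h]
  -- The factor 8 is the covering loss 4 times the 2 lost in rounding up the number of messages.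
  have hbig : ∀ᶠ n : ℕ in atTop, (8 : ℝ) ≤ 2 ^ (n * (δ / 2)) := by
    have h1 : Tendsto (fun n : ℕ => (n : ℝ) * (δ / 2)) atTop atTop :=
      tendsto_natCast_atTop_atTop.atTop_mul_const (by positivity)
    filter_upwards [h1.eventually_ge_atTop 3] with n hn
    calc (8 : ℝ) = 2 ^ (3 : ℝ) := by norm_num
      _ ≤ _ := Real.rpow_le_rpow_of_exponent_le one_le_two hn
  filter_upwards [hbig,
    eventually_rpow_le_of_tendsto_logb_div (fun n => ncard_orbit_pos _)
      (tendsto_logb_ncard_orbit_top hp hu y) (by linarith : R - δ / 2 < entropy p y),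
    eventually_rpow_le_of_tendsto_logb_div (fun n => ncard_orbit_pos _)
      (tendsto_logb_ncard_orbit hp.1 hu y b) (by linarith : R - d - δ / 2 < condEntropy p y b),
    eventually_rpow_le_of_tendsto_logb_div (fun n => ncard_orbit_pos _)
      (tendsto_logb_ncard_orbit hp.1 hu y a) (by linarith : R - da - δ / 2 < condEntropy p y a)]
    with n h8 hO hOb hOa
  obtain ⟨C, Wa, Wb, hWa, hWb, hC, hmin⟩ := exists_finset_outputs (u n) y a b hab
    (numMessages d n) (numMessages (da - d) n)
  set O := (orbit (Equiv.Perm (Fin n))ᵈᵐᵃ fun i => y (u n i)).ncard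
  set Ob := (orbit (stabilizer (Equiv.Perm (Fin n))ᵈᵐᵃ fun i => b (u n i))
    fun i => y (u n i)).ncard
  set Oa := (orbit (stabilizer (Equiv.Perm (Fin n))ᵈᵐᵃ fun i => a (u n i))
    fun i => y (u n i)).ncard
  have hk : (2 : ℝ) ^ (n * d) ≤ numMessages d n := Nat.le_ceil _
  have hm : (2 : ℝ) ^ (n * (da - d)) ≤ numMessages (da - d) n := Nat.le_ceil _
  have hk2 := numMessages_le_two_mul hd0 n
  have hm2 := numMessages_le_two_mul hda' n
  refine ⟨C, Wa, Wb, ?_, ?_, ?_, hC⟩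
  · have hadd : ∀ s t v : ℝ, s + t = v → (2 : ℝ) ^ (n * v) = 2 ^ (n * s) * 2 ^ (n * t) := by
      rintro s t v rfl
      rw [mul_add, Real.rpow_add two_pos]
    -- Each of the three terms has exponent at least `R - δ / 2`, the powers of `k` and `m` making
    -- up for the smaller orbits.
    have hlow : (2 : ℝ) ^ (n * (R - δ / 2)) ≤
        min (O : ℝ) (numMessages d n * min (Ob : ℝ) (numMessages (da - d) n * Oa)) := by
      rw [mul_min_of_nonneg _ _ (Nat.cast_nonneg _)]
      refine le_min hO (le_min ?_ ?_)
      · rw [hadd d (R - d - δ / 2) _ (by ring)]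
        gcongr
      · rw [hadd d (R - d - δ / 2) _ (by ring), hadd (da - d) (R - da - δ / 2) (R - d - δ / 2)
          (by ring)]
        gcongr
    have hmin' : min (O : ℝ) (numMessages d n * min (Ob : ℝ) (numMessages (da - d) n * Oa)) ≤
        4 * C.card := by exact_mod_cast hmin
    have hM := numMessages_le_two_mul (sub_nonneg.2 hδR) n
    rw [hadd (R - δ) (δ / 2) _ (by ring)] at hlow
    have h8' := mul_le_mul_of_nonneg_left h8
      (Real.rpow_nonneg zero_le_two ((n : ℝ) * (R - δ)))
    have : (numMessages (R - δ) n : ℝ) ≤ C.card := by linarith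
    exact_mod_cast this
  · calc (Wa.card : ℝ) ≤ numMessages d n * numMessages (da - d) n := by exact_mod_cast hWa
      _ ≤ (2 * 2 ^ (n * d)) * (2 * 2 ^ (n * (da - d))) := by gcongr
      _ = 2 ^ (2 + n * da) := by
          rw [show (2 : ℝ) + n * da = 2 + (n * d + n * (da - d)) by ring, Real.rpow_add two_pos,
            Real.rpow_add two_pos (n * d), Real.rpow_two]
          ring
  · calc (Wb.card : ℝ) ≤ numMessages d n := by exact_mod_cast hWb
      _ ≤ 2 * 2 ^ (n * d) := hk2
      _ = 2 ^ (1 + n * d) := by rw [Real.rpow_add two_pos, Real.rpow_one]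
      _ ≤ 2 ^ (2 + n * db) := by
          gcongr
          · exact one_le_two
          · norm_num
          · exact min_le_right _ _

theorem mem_rateDisturbanceRegion_of_refines {Z : Fin 2 → Type*} [∀ j, Fintype (Z j)]
    (y : X → Y) (z : ∀ j, X → Z j) {a b : Fin 2} (hne : a ≠ b) (hab : Refines (z a) (z b))
    {t : ℝ × (Fin 2 → ℝ)} (h₁ : 0 ≤ t.1) (h₂ : ∀ j, 0 ≤ t.2 j) {p : X → ℝ}
    (hp : p ∈ stdSimplex ℝ X) (hy : t.1 ≤ entropy p y)
    (hz : ∀ j, t.1 - t.2 j ≤ condEntropy p y (z j)) :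
    t ∈ rateDisturbanceRegion (deterministicChannel y z) := by
  have hX : Nonempty X := by
    by_contra h
    rw [not_nonempty_iff] at h
    simpa using hp.2
  obtain ⟨R, d⟩ := t
  rcases h₁.eq_or_lt with h | hR
  · obtain rfl : 0 = R := h
    exact subset_closure (achievable_rate_zero y z h₂)
  have hlim : Tendsto (fun δ : ℝ => (R - δ, d)) (𝓝[>] 0) (𝓝 (R, d)) := by
    have : Tendsto (fun δ : ℝ => (R - δ, d)) (𝓝 0) (𝓝 (R - 0, d)) :=
      Continuous.tendsto (by fun_prop) 0
    rw [sub_zero] at this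
    exact this.mono_left nhdsWithin_le_nhds
  refine mem_closure_of_tendsto hlim ?_
  filter_upwards [Ioc_mem_nhdsGT hR] with δ ⟨hδ, hδR⟩
  have hj : ∀ j : Fin 2, j = a ∨ j = b := by omega
  -- The 2 extra bits, vanishing after division by `n`, pay for rounding up both `k` and `m`.
  refine achievable_of_eventually_exists_code (sub_nonneg.2 hδR) h₂
    (D := fun n j => 1 / (n : ℝ) * (2 + n * d j)) (fun j => ?_) ?_
  · have h := (tendsto_one_div_atTop_nhds_zero_nat.mul_const (2 : ℝ)).add_const (d j)
    rw [zero_mul, zero_add] at h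
    refine h.congr' ?_
    filter_upwards [eventually_gt_atTop 0] with n hn
    field_simp
  · filter_upwards [eventually_exists_outputs hp y hab hδ hδR (h₂ a) (h₂ b) hy (hz a) (hz b)]
      with n ⟨C, Wa, Wb, hC, hWa, hWb, hu⟩
    obtain ⟨W, rfl, rfl⟩ : ∃ W : ∀ j, Finset (Fin n → Z j), W a = Wa ∧ W b = Wb :=
      ⟨Function.update (Function.update (fun _ => ∅) a Wa) b Wb, by simp [hne], by simp⟩
    obtain ⟨c, hc, hc'⟩ := exists_code (R := R - δ) y z C W hC fun c hc => by
      obtain ⟨u, hu1, hua, hub⟩ := hu c hc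
      exact ⟨u, hu1, fun j => by rcases hj j with rfl | rfl <;> assumption⟩
    refine ⟨c, hc, fun j => (hc' j).trans ?_⟩
    have hcard : ((W j).card : ℝ) ≤ 2 ^ (2 + n * d j) := by
      rcases hj j with rfl | rfl <;> assumption
    gcongr
    -- For an empty `W j` the convention `logb 2 0 = 0` leaves only the nonnegativity of the bound.
    rcases (W j).card.eq_zero_or_pos with h0 | h0
    · rw [h0, Nat.cast_zero, Real.logb_zero]
      have := h₂ j
      dsimp only at this
      positivity
    · rwa [Real.logb_le_iff_le_rpow one_lt_two (by exact_mod_cast h0)]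

end Achievability
end Disturbance

end

theorem mainTheorem7 {X Y : Type*} {Z : Fin 2 → Type*} [Fintype X] [Fintype Y]
    [∀ j, Fintype (Z j)] (y : X → Y) (z : ∀ j, X → Z j)
    (hz : Disturbance.Refines (z 0) (z 1) ∨ Disturbance.Refines (z 1) (z 0)) :
    Disturbance.rateDisturbanceRegion (Disturbance.deterministicChannel y z) =
      {t : ℝ × (Fin 2 → ℝ) | 0 ≤ t.1 ∧ 0 ≤ t.2 0 ∧ 0 ≤ t.2 1 ∧
        ∃ p ∈ stdSimplex ℝ X,
          t.1 ≤ Disturbance.entropy p y ∧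
          t.1 - t.2 0 ≤ Disturbance.condEntropy p y (z 0) ∧
          t.1 - t.2 1 ≤ Disturbance.condEntropy p y (z 1)} := by
  have hset : {t : ℝ × (Fin 2 → ℝ) | 0 ≤ t.1 ∧ 0 ≤ t.2 0 ∧ 0 ≤ t.2 1 ∧
        ∃ p ∈ stdSimplex ℝ X,
          t.1 ≤ Disturbance.entropy p y ∧
          t.1 - t.2 0 ≤ Disturbance.condEntropy p y (z 0) ∧
          t.1 - t.2 1 ≤ Disturbance.condEntropy p y (z 1)} =
      {t | 0 ≤ t.1} ∩ {t | ∀ j, 0 ≤ t.2 j} ∩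
        {t | ∃ p ∈ stdSimplex ℝ X, t.1 ≤ Disturbance.entropy p y ∧
          ∀ j, t.1 - t.2 j ≤ Disturbance.condEntropy p y (z j)} := by
    ext t
    simp only [Set.mem_inter_iff, Set.mem_ofPred_eq, Fin.forall_fin_two, and_assoc]
  rw [hset]
  refine Set.Subset.antisymm (closure_minimal ?_ ?_) ?_
  · exact fun t ht => ⟨⟨ht.1, ht.2.1⟩, Disturbance.mem_singleLetterRegion_of_achievable y z ht⟩
  · refine ((isClosed_le continuous_const continuous_fst).inter ?_).inter
      (Disturbance.isClosed_singleLetterRegion y z)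
    simp only [Set.ofPred_forall]
    exact isClosed_iInter fun j => isClosed_le continuous_const (by fun_prop)
  · rintro t ⟨⟨h₁, h₂⟩, p, hp, hy, hj⟩
    rcases hz with h | h
    · exact Disturbance.mem_rateDisturbanceRegion_of_refines y z zero_ne_one h h₁ h₂ hp hy hj
    · exact Disturbance.mem_rateDisturbanceRegion_of_refines y z one_ne_zero h h₁ h₂ hp hy hj
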